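/- A ring $R$ with identity (not necessarily commutative) is said to fully realize a group $G$ if $R^\times \cong G$ and, under this identification, every group endomorphism of $G$ is the restriction to $R^\times$ of some unital ring endomorphism of $R$; a group is fully realizable if some ring fully realizes it. Let $n$ be a positive integer and let $\mathbf{S}_n$ be the symmetric group on $n$ letters. The following are equivalent: (1) $n = 1$ or $n = 2$; (2) $\mathbf{S}_n$ is fully realizable; (3) $\mathbf{S}_n$ is simple, in the sense that its only normal subgroups are the trivial subgroup and $\mathbf{S}_n$ itself (here the trivial group $\mathbf{S}_1$ is admitted). -/

import Mathlib

universe u v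

/-- The ring `R` (with identity, not necessarily commutative) fully realizes the group `G`: under
some identification `e` of the unit group `Rˣ` with `G`, every group endomorphism of `G` is induced
by a (unital) ring endomorphism of `R`. -/
def FullyRealizes (R : Type u) [Ring R] (G : Type v) [Group G] : Prop :=
  ∃ e : Rˣ ≃* G, ∀ f : G →* G, ∃ φ : R →+* R,
    ∀ x : Rˣ, e (Units.map (φ : R →* R) x) = f (e x)

/-- The group `G` is fully realizable: some ring (with carrier in `Type u`) fully realizes it. -/
def FullyRealizable (G : Type v) [Group G] : Prop :=
  ∃ (R : Type u) (_ : Ring R), FullyRealizes R G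

/-- The only normal subgroups of `G` are the trivial one and `G` itself. Unlike `IsSimpleGroup`,
this admits the trivial group; for nontrivial groups the two notions agree. -/
def HasOnlyTrivialNormalSubgroups (G : Type v) [Group G] : Prop :=
  ∀ N : Subgroup G, N.Normal → N = ⊥ ∨ N = ⊤

section

open Equiv

/-! Let `R` fully realize S_n, n ≥ 3. The trivial endomorphism forces `-1 = 1`, so z² = 0 makes 1 +
z a unit, that is, a permutation. The sum N over a copy of S_3 has N² = 6N = 0, so 1 + N is a
permutation c; the sign map onto {1, a} shows c ≠ 1. But c centralizes S_3 × S_{n-3}, whose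
centralizer is trivial unless n = 5. For n = 5, c = (3 4), and a second square-zero element yields
(1 + x)(1 + y) = 0 for distinct braided transpositions x, y, which is impossible. For n ≤ 2, F_2 and
its dual numbers work. -/

/-- In characteristic two, involutions satisfying the braid relation and `(1 + x) * (1 + y) = 0`
are equal. -/
theorem eq_of_one_add_mul_one_add_eq_zero {R : Type*} [Ring R] (h2 : ∀ r : R, r + r = 0) {x y : R}
    (hx : x * x = 1) (hy : y * y = 1) (hxy : x * y * x = y * x * y)
    (h : (1 + x) * (1 + y) = 0) : x = y := by
  have e : x * y = 1 + x + y := by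
    linear_combination (norm := noncomm_ring) h - h2 1 - h2 x - h2 y
  have e1 : x * y * x = x + 1 + y * x := by rw [e, add_mul, add_mul, hx, one_mul]
  have e2 : y * x * y = y + y * x + 1 := by rw [mul_assoc, e, mul_add, mul_add, hy, mul_one]
  linear_combination (norm := noncomm_ring) hxy - e1 + e2

/-- The sum over the dihedral group of order six generated by two braided involutions. -/
def dihedralSum {R : Type*} [Ring R] (a b : R) : R :=
  1 + a + b + a * b + b * a + a * b * a

section DihedralSum

variable {R : Type*} [Ring R] {a b : R}

theorem mul_dihedralSum_left (ha : a * a = 1) : a * dihedralSum a b = dihedralSum a b := by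
  have h (x : R) : a * (a * x) = x := by rw [← mul_assoc, ha, one_mul]
  simp only [dihedralSum, mul_add, mul_assoc, ha, h, mul_one]
  abel

theorem dihedralSum_mul_left (ha : a * a = 1) : dihedralSum a b * a = dihedralSum a b := by
  simp only [dihedralSum, add_mul, mul_assoc, ha, mul_one, one_mul]
  abel

theorem dihedralSum_comm (hab : a * b * a = b * a * b) : dihedralSum a b = dihedralSum b a := by
  simp only [dihedralSum, hab]
  abel

/-- Each of the six terms fixes the sum, so the square is six copies of it. -/
theorem dihedralSum_mul_self (h2 : ∀ r : R, r + r = 0) (ha : a * a = 1) (hb : b * b = 1)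
    (hab : a * b * a = b * a * b) : dihedralSum a b * dihedralSum a b = 0 := by
  have hA := mul_dihedralSum_left (b := b) ha
  have hB : b * dihedralSum a b = dihedralSum a b := by
    rw [dihedralSum_comm hab, mul_dihedralSum_left hb]
  generalize hN : dihedralSum a b = N at *
  nth_rw 1 [← hN]
  simp only [dihedralSum, add_mul, mul_assoc, hA, hB, one_mul, h2, zero_add]

theorem Commute.dihedralSum_right {g : R} (ha : Commute g a) (hb : Commute g b) :
    Commute g (dihedralSum a b) :=
  (((((Commute.one_right g).add_right ha).add_right hb).add_right (ha.mul_right hb)).add_right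
    (hb.mul_right ha)).add_right ((ha.mul_right hb).mul_right ha)

end DihedralSum

/-! ### Centralizers in symmetric groups -/

namespace Equiv.Perm

theorem apply_eq_or_of_commute_swap {α : Type*} [DecidableEq α] {c : Perm α}
    {i j : α} (hij : i ≠ j) (h : Commute c (swap i j)) : c i = i ∨ c i = j := by
  by_contra! hc
  have h1 := congrArg (fun p : Perm α => p i) h.eq
  simp only [Perm.mul_apply, swap_apply_left, swap_apply_of_ne_of_ne hc.1 hc.2] at h1
  exact hij (c.injective h1).symm

theorem apply_eq_of_commute_swap {α : Type*} [DecidableEq α] {c : Perm α}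
    {i j k : α} (hij : i ≠ j) (hik : i ≠ k) (hjk : j ≠ k) (hj : Commute c (swap i j))
    (hk : Commute c (swap i k)) : c i = i := by
  have := apply_eq_or_of_commute_swap hij hj
  have := apply_eq_or_of_commute_swap hik hk
  grind

/-- For `n ≠ 5` the Young subgroup of type `(3, n - 3)` has trivial centralizer. -/
theorem eq_one_of_commute_young {n : ℕ} (hn : 3 ≤ n) (h5 : n ≠ 5) {c : Perm (Fin n)}
    (h : ∀ i j : Fin n, (i.val < 3 ↔ j.val < 3) → Commute c (swap i j)) : c = 1 := by
  have key (i : Fin n) (j k : ℕ) (hj : j < n) (hk : k < n) (hij : i.val ≠ j) (hik : i.val ≠ k)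
      (hjk : j ≠ k) (h1 : i.val < 3 ↔ j < 3) (h2 : i.val < 3 ↔ k < 3) : c i = i :=
    apply_eq_of_commute_swap (j := ⟨j, hj⟩) (k := ⟨k, hk⟩) (by grind) (by grind) (by grind)
      (h _ _ h1) (h _ _ h2)
  have small (i : Fin n) (hi : i.val < 3) : c i = i := by
    rcases (by omega : i.val = 0 ∨ i.val = 1 ∨ i.val = 2) with h0 | h0 | h0
    · exact key i 1 2 (by omega) (by omega) (by omega) (by omega) (by omega) (by omega) (by omega)
    · exact key i 0 2 (by omega) (by omega) (by omega) (by omega) (by omega) (by omega) (by omega)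
    · exact key i 0 1 (by omega) (by omega) (by omega) (by omega) (by omega) (by omega) (by omega)
  ext1 i
  rw [Perm.one_apply]
  by_cases hi : i.val < 3
  · exact small i hi
  -- For n = 4 the block outside {0, 1, 2} is a single point, so injectivity decides.
  by_cases h4 : n = 4
  · by_cases hci : (c i).val < 3
    · exact c.injective (small _ hci)
    · grind
  rcases (by omega : i.val = 3 ∨ i.val = 4 ∨ 5 ≤ i.val) with h0 | h0 | h0
  · exact key i 4 5 (by omega) (by omega) (by omega) (by omega) (by omega) (by omega) (by omega)
  · exact key i 3 5 (by omega) (by omega) (by omega) (by omega) (by omega) (by omega) (by omega)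
  · exact key i 3 4 (by omega) (by omega) (by omega) (by omega) (by omega) (by omega) (by omega)

-- The exceptional case: the factor S_2 is its own centre.
set_option maxRecDepth 100000 in
theorem eq_of_commute_swap_fin_five_three : ∀ c : Perm (Fin 5),
    c * swap 0 1 = swap 0 1 * c → c * swap 1 2 = swap 1 2 * c → c = 1 ∨ c = swap 3 4 := by
  decide

set_option maxRecDepth 100000 in
theorem eq_of_commute_swap_fin_five_two : ∀ c : Perm (Fin 5),
    c * swap 0 1 = swap 0 1 * c → c * swap 3 4 = swap 3 4 * c → sign c = 1 →
      c = 1 ∨ c = swap 0 1 * swap 3 4 := by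
  decide

/-- The endomorphism sending even elements to `1` and odd ones to a given involution. -/
def signTo {α : Type*} [DecidableEq α] [Fintype α] (t : Perm α) (ht : t * t = 1) :
    Perm α →* Perm α where
  toFun g := if sign g = 1 then 1 else t
  map_one' := by simp
  map_mul' x y := by
    rcases Int.units_eq_one_or (sign x) with hx | hx <;>
      rcases Int.units_eq_one_or (sign y) with hy | hy <;> simp [hx, hy, ht]

end Equiv.Perm

/-! ### Square-zero elements and units of a realization -/

/-- What full realization of `Perm (Fin n)` by `R` gives: an embedding `ι` onto the units of `R`,
characteristic two, and a ring endomorphism `φ` inducing the sign map onto `{1, a}`. -/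
structure SymmetricRealization (n : ℕ) (R : Type*) [Ring R] (a : Perm (Fin n)) where
  ι : Perm (Fin n) →* R
  inj : Function.Injective ι
  isUnit_mem : ∀ x : R, IsUnit x → ∃ g, ι g = x
  add_self : ∀ r : R, r + r = 0
  φ : R →+* R
  φ_even : ∀ g, Perm.sign g = 1 → φ (ι g) = 1
  φ_odd : ∀ g, Perm.sign g ≠ 1 → φ (ι g) = ι a

theorem FullyRealizes.nonempty_symmetricRealization {n : ℕ} {R : Type*} [Ring R]
    (h : FullyRealizes R (Perm (Fin n))) (a : Perm (Fin n)) (ha : a * a = 1) :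
    Nonempty (SymmetricRealization n R a) := by
  obtain ⟨e, he⟩ := h
  have hφ (f : Perm (Fin n) →* Perm (Fin n)) :
      ∃ φ : R →+* R, ∀ g, φ (e.symm g : Rˣ) = (e.symm (f g) : Rˣ) := by
    obtain ⟨φ, hφ⟩ := he f
    refine ⟨φ, fun g => ?_⟩
    have := hφ (e.symm g)
    rw [e.apply_symm_apply] at this
    rw [← this]
    simp
  obtain ⟨ψ, hψ⟩ := hφ 1
  obtain ⟨φ, hφ⟩ := hφ (Perm.signTo a ha)
  -- `ψ` sends every unit to 1, yet fixes -1.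
  have h1 : (-1 : R) = 1 := by
    have := hψ (e (-1))
    simpa using this
  refine ⟨⟨(Units.coeHom R).comp e.symm.toMonoidHom, ?_, ?_, ?_, φ, ?_, ?_⟩⟩
  · exact Units.val_injective.comp e.symm.injective
  · rintro _ ⟨u, rfl⟩
    exact ⟨e u, by simp⟩
  · intro r
    calc r + r = r + 1 * r := by rw [one_mul]
      _ = r + -1 * r := by rw [h1]
      _ = 0 := by simp
  · intro g hg
    simpa [Perm.signTo, hg] using hφ g
  · intro g hg
    simpa [Perm.signTo, hg] using hφ g

namespace SymmetricRealization

variable {n : ℕ} {R : Type*} [Ring R] {a : Perm (Fin n)} (S : SymmetricRealization n R a)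

theorem exists_eq_one_add {z : R} (hz : z * z = 0) : ∃ c, S.ι c = 1 + z := by
  have h : (1 + z) * (1 + z) = 1 := by
    linear_combination (norm := noncomm_ring) hz + S.add_self z
  exact S.isUnit_mem _ ⟨⟨_, _, h, h⟩, rfl⟩

theorem commute_of_eq_one_add {g h : Perm (Fin n)} {z : R} (hg : S.ι g = 1 + z)
    (hz : Commute (S.ι h) z) : Commute g h := by
  apply S.inj
  rw [map_mul, map_mul, hg]
  exact ((Commute.one_right _).add_right hz).symm.eq

theorem ι_mul_self {t : Perm (Fin n)} (ht : t * t = 1) : S.ι t * S.ι t = 1 := by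
  rw [← map_mul, ht, map_one]

/-- The unit `1 + ∑ g` over a symmetric group on three letters comes from some `c ≠ 1`. -/
theorem exists_eq_one_add_dihedralSum {b : Perm (Fin n)} (ha : a * a = 1) (hb : b * b = 1)
    (hab : a * b * a = b * a * b) (hsa : Perm.sign a = -1) (hsb : Perm.sign b = -1) :
    ∃ c ≠ 1, S.ι c = 1 + dihedralSum (S.ι a) (S.ι b) := by
  have hab' : S.ι a * S.ι b * S.ι a = S.ι b * S.ι a * S.ι b := by
    simp only [← map_mul, hab]
  obtain ⟨c, hc⟩ := S.exists_eq_one_add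
    (dihedralSum_mul_self S.add_self (S.ι_mul_self ha) (S.ι_mul_self hb) hab')
  refine ⟨c, ?_, hc⟩
  rintro rfl
  have h0 : dihedralSum (S.ι a) (S.ι b) = 0 := by simpa using hc
  -- `φ` sends both involutions to `ι a`, so the sum becomes 3 + 3a = 1 + a.
  have h := congrArg S.φ h0
  have hA : S.φ (S.ι a) = S.ι a := S.φ_odd a (by simp [hsa])
  have hB : S.φ (S.ι b) = S.ι a := S.φ_odd b (by simp [hsb])
  simp only [dihedralSum, map_add, map_mul, map_one, hA, hB, S.ι_mul_self ha, one_mul,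
    map_zero] at h
  have h1 : S.ι a = S.ι 1 := by
    rw [map_one]
    linear_combination (norm := noncomm_ring) h - S.add_self 1 - S.add_self 1 - S.add_self (S.ι a)
  rw [S.inj h1] at hsa
  simp at hsa

theorem eq_five (hn : 3 ≤ n)
    (S : SymmetricRealization n R (swap ⟨0, by omega⟩ ⟨1, by omega⟩)) : n = 5 := by
  by_contra h5
  set p : Fin n := ⟨0, by omega⟩ with hp
  set q : Fin n := ⟨1, by omega⟩ with hq
  set r : Fin n := ⟨2, by omega⟩ with hr
  have hpq : p ≠ q := by simp [hp, hq]
  have hqr : q ≠ r := by simp [hq, hr]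
  have hpr : p ≠ r := by simp [hp, hr]
  have hconj : swap p q * swap q r * swap p q = swap p r := by
    rw [swap_comm p q, swap_comm q r, swap_mul_swap_mul_swap hqr.symm hpr.symm]
  have hconj' : swap q r * swap p q * swap q r = swap p r := by
    rw [swap_mul_swap_mul_swap hpq hpr, swap_comm]
  obtain ⟨c, hc1, hc⟩ := S.exists_eq_one_add_dihedralSum (b := swap q r) (swap_mul_self _ _)
    (swap_mul_self _ _) (hconj.trans hconj'.symm) (Perm.sign_swap hpq) (Perm.sign_swap hqr)
  have hpq' : Commute c (swap p q) := S.commute_of_eq_one_add hc <| by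
    rw [commute_iff_eq, mul_dihedralSum_left (S.ι_mul_self (swap_mul_self _ _)),
      dihedralSum_mul_left (S.ι_mul_self (swap_mul_self _ _))]
  have hqr' : Commute c (swap q r) := S.commute_of_eq_one_add hc <| by
    rw [dihedralSum_comm (by simp only [← map_mul, hconj, hconj']), commute_iff_eq,
      mul_dihedralSum_left (S.ι_mul_self (swap_mul_self _ _)),
      dihedralSum_mul_left (S.ι_mul_self (swap_mul_self _ _))]
  have hpr' : Commute c (swap p r) := by
    rw [← hconj]
    exact (hpq'.mul_right hqr').mul_right hpq'
  refine hc1 (Perm.eq_one_of_commute_young hn h5 fun i j hij => ?_)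
  by_cases hi : i.val < 3
  · have hi' : i = p ∨ i = q ∨ i = r := by grind
    have hj' : j = p ∨ j = q ∨ j = r := by grind
    rcases hi' with rfl | rfl | rfl <;> rcases hj' with rfl | rfl | rfl <;>
      first
      | assumption
      | (rw [swap_comm]; assumption)
      | (rw [swap_self]; exact Commute.one_right c)
  · have h (k : Fin n) (hk : k.val < 3) : k ≠ i ∧ k ≠ j := by grind
    have hd (k l : Fin n) (hk : k.val < 3) (hl : l.val < 3) :
        Commute (S.ι (swap i j)) (S.ι (swap k l)) := by
      refine Commute.map ?_ S.ι
      rw [commute_iff_eq, mul_swap_eq_swap_mul,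
        swap_apply_of_ne_of_ne (h k hk).1 (h k hk).2, swap_apply_of_ne_of_ne (h l hl).1 (h l hl).2]
    exact S.commute_of_eq_one_add hc
      ((hd p q (by simp [hp]) (by simp [hq])).dihedralSum_right
        (hd q r (by simp [hq]) (by simp [hr])))

theorem false_of_five (S : SymmetricRealization 5 R (swap 0 1)) : False := by
  have sq (i j : Fin 5) : S.ι (swap i j) * S.ι (swap i j) = 1 := S.ι_mul_self (swap_mul_self i j)
  have one_add_mul_eq_zero {x : R} {z : R} (h : x * z = z) : (1 + x) * z = 0 := by
    rw [add_mul, one_mul, h, S.add_self]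
  have one_add_sq {x : R} (h : x * x = 1) : (1 + x) * (1 + x) = 0 := by
    linear_combination (norm := noncomm_ring) h + S.add_self x + S.add_self 1
  have braid (i j k : Fin 5) (hij : i ≠ j) (hik : i ≠ k) (hjk : j ≠ k) :
      (1 + S.ι (swap i j)) * (1 + S.ι (swap i k)) ≠ 0 := fun h => by
    have := eq_of_one_add_mul_one_add_eq_zero S.add_self (sq i j) (sq i k)
      (by
        simp only [← map_mul]
        congr 1
        rw [swap_comm i k, swap_mul_swap_mul_swap hik.symm hjk.symm, swap_comm k i,
          swap_comm i j, swap_mul_swap_mul_swap hij.symm hjk, swap_comm]) h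
    have := congrArg (fun p : Perm (Fin 5) => p i) (S.inj this)
    simp only [swap_apply_left] at this
    exact hjk this
  obtain ⟨c, hc1, hc⟩ := S.exists_eq_one_add_dihedralSum (b := swap 1 2) (swap_mul_self _ _)
    (swap_mul_self _ _) (by decide) (by decide) (by decide)
  have hA := mul_dihedralSum_left (b := S.ι (swap 1 2)) (sq 0 1)
  have hA' := dihedralSum_mul_left (b := S.ι (swap 1 2)) (sq 0 1)
  have hcomm : dihedralSum (S.ι (swap 0 1)) (S.ι (swap 1 2)) =
      dihedralSum (S.ι (swap 1 2)) (S.ι (swap 0 1)) :=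
    dihedralSum_comm (by simp only [← map_mul]; congr 1; decide)
  have hB := mul_dihedralSum_left (b := S.ι (swap 0 1)) (sq 1 2)
  have hB' := dihedralSum_mul_left (b := S.ι (swap 0 1)) (sq 1 2)
  rw [← hcomm] at hB hB'
  have hcs : c = swap 3 4 := (Perm.eq_of_commute_swap_fin_five_three c
    (S.commute_of_eq_one_add hc (hA.trans hA'.symm))
    (S.commute_of_eq_one_add hc (hB.trans hB'.symm))).resolve_left hc1
  have hN : dihedralSum (S.ι (swap 0 1)) (S.ι (swap 1 2)) = 1 + S.ι (swap 3 4) := by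
    rw [← hcs, hc, ← add_assoc, S.add_self, zero_add]
  rw [hN] at hA hB
  have h02 : (1 + S.ι (swap 0 2)) * (1 + S.ι (swap 3 4)) = 0 := one_add_mul_eq_zero <| by
    rw [show (swap 0 2 : Perm (Fin 5)) = swap 0 1 * swap 1 2 * swap 0 1 by decide, map_mul, map_mul,
      mul_assoc, hA, mul_assoc, hB, hA]
  set t := S.ι (swap 0 1) with ht
  set d := S.ι (swap 3 4) with hd
  set g := S.ι (swap 1 3) with hg
  have htt : t * t = 1 := sq 0 1
  have hdd : d * d = 1 := sq 3 4
  have htd : (1 + t) * (1 + d) = 0 := one_add_mul_eq_zero hA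
  -- The square contains the factor (1 + t)(1 + d) = 0.
  obtain ⟨w, hw⟩ := S.exists_eq_one_add (z := (1 + d) * g * (1 + t)) <| by
    rw [show (1 + d) * g * (1 + t) * ((1 + d) * g * (1 + t)) =
      (1 + d) * g * ((1 + t) * (1 + d)) * (g * (1 + t)) by noncomm_ring, htd]
    simp
  have hdz : d * ((1 + d) * g * (1 + t)) = (1 + d) * g * (1 + t) := by
    rw [← mul_assoc, ← mul_assoc, mul_add d, hdd, mul_one, add_comm d]
  have hzt : (1 + d) * g * (1 + t) * t = (1 + d) * g * (1 + t) := by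
    rw [mul_assoc, add_mul 1 t, htt, one_mul, add_comm t]
  have htz : t * ((1 + d) * g * (1 + t)) = (1 + d) * g * (1 + t) := by
    rw [← mul_assoc, ← mul_assoc, hA]
  have hzd : (1 + d) * g * (1 + t) * d = (1 + d) * g * (1 + t) := by
    have : (1 + t) * d = 1 + t := by
      linear_combination (norm := noncomm_ring) htd - S.add_self 1 - S.add_self t
    rw [mul_assoc, this]
  -- `φ` maps t, d and g to t, so it kills (1 + d)g(1 + t), as (1 + t)² = 0.
  have hsw : Perm.sign w = 1 := by
    by_contra hsw
    have h1 := S.φ_odd w hsw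
    have hφd : S.φ d = t := S.φ_odd _ (by decide)
    have hφg : S.φ g = t := S.φ_odd _ (by decide)
    have hφt : S.φ t = t := S.φ_odd _ (by decide)
    rw [hw] at h1
    simp only [map_add, map_mul, map_one, hφd, hφg, hφt] at h1
    have : t = 1 := by
      rw [← ht] at h1
      rw [← h1, show (1 + t) * t * (1 + t) = t * ((1 + t) * (1 + t)) by noncomm_ring,
        one_add_sq htt]
      simp
    have : (swap 0 1 : Perm (Fin 5)) = 1 := S.inj (by rw [map_one, ← ht, this])
    exact absurd this (by decide)
  rcases Perm.eq_of_commute_swap_fin_five_two w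
    (S.commute_of_eq_one_add hw (htz.trans hzt.symm))
    (S.commute_of_eq_one_add hw (hdz.trans hzd.symm)) hsw with rfl | rfl
  · have hz : (1 + d) * g * (1 + t) = 0 := by simpa using hw
    -- Conjugation by (1 3) turns (0 1) into (0 3), which braids with (3 4).
    have hgt : g * (1 + t) * g = 1 + S.ι (swap 3 0) := by
      rw [mul_add, add_mul, mul_one, hg, sq, ht, ← map_mul, ← map_mul]
      congr 2
      decide
    refine braid 3 4 0 (by decide) (by decide) (by decide) ?_
    rw [← hgt, ← hd, ← mul_assoc, ← mul_assoc, hz, zero_mul]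
  · have hz : (1 + d) * g * (1 + t) = (1 + t) + (1 + d) := by
      rw [map_mul, ← ht, ← hd] at hw
      linear_combination (norm := noncomm_ring) htd - hw - S.add_self 1 - S.add_self 1 - S.add_self t - S.add_self d
    -- Left multiplication by 1 + (0 2) kills 1 + d, leaving only its product with 1 + t.
    refine braid 0 2 1 (by decide) (by decide) (by decide) ?_
    have h := congrArg (fun x => (1 + S.ι (swap 0 2)) * x) hz
    simpa only [← mul_assoc, h02, zero_mul, mul_add _ (1 + t), add_zero, eq_comm] using h

end SymmetricRealization

theorem not_fullyRealizes_perm_fin {n : ℕ} (hn : 3 ≤ n) {R : Type*} [Ring R] :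
    ¬ FullyRealizes R (Perm (Fin n)) := fun h => by
  obtain ⟨S⟩ := h.nonempty_symmetricRealization (swap ⟨0, by omega⟩ ⟨1, by omega⟩)
    (swap_mul_self _ _)
  obtain rfl := SymmetricRealization.eq_five hn S
  exact S.false_of_five

/-! ### Realizations for n ≤ 2 -/

theorem FullyRealizes.of_ringEquiv {R R' G : Type*} [Ring R] [Ring R'] [Group G] (E : R' ≃+* R)
    (h : FullyRealizes R G) : FullyRealizes R' G := by
  obtain ⟨e, he⟩ := h
  refine ⟨(Units.mapEquiv E.toMulEquiv).trans e, fun f => ?_⟩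
  obtain ⟨φ, hφ⟩ := he f
  refine ⟨(E.symm : R →+* R').comp (φ.comp (E : R' →+* R)), fun x => ?_⟩
  rw [MulEquiv.trans_apply, MulEquiv.trans_apply, ← hφ]
  congr 1
  ext
  simp

theorem fullyRealizes_zmod_two (G : Type*) [Group G] [Subsingleton G] :
    FullyRealizes (ZMod 2) G :=
  ⟨{ toFun := 1, invFun := 1, left_inv := fun _ => Subsingleton.elim _ _,
     right_inv := fun _ => Subsingleton.elim _ _, map_mul' := fun _ _ => Subsingleton.elim _ _ },
    fun _ => ⟨RingHom.id _, fun _ => Subsingleton.elim _ _⟩⟩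

theorem card_units_dualNumber_zmod_two : Nat.card (DualNumber (ZMod 2))ˣ = 2 := by
  let _ : Fintype (DualNumber (ZMod 2)) := inferInstanceAs (Fintype (ZMod 2 × ZMod 2))
  let _ : DecidableEq (DualNumber (ZMod 2)) := inferInstanceAs (DecidableEq (ZMod 2 × ZMod 2))
  rw [Nat.card_eq_fintype_card]
  decide

/-- The dual numbers over the field with two elements fully realize the group of order two. -/
theorem fullyRealizes_dualNumber {G : Type*} [Group G] (hG : Nat.card G = 2) :
    FullyRealizes (DualNumber (ZMod 2)) G := by
  have e : (DualNumber (ZMod 2))ˣ ≃* G :=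
    mulEquivOfPrimeCardEq (p := 2) card_units_dualNumber_zmod_two hG
  refine ⟨e, fun f => ?_⟩
  obtain ⟨x, y, hxy, huniv⟩ := Nat.card_eq_two_iff.mp hG
  have two (g h : G) (hg : g ≠ 1) (hh : h ≠ 1) : g = h := by
    have h1 : ∀ k : G, k = x ∨ k = y := fun k => by
      have : k ∈ ({x, y} : Set G) := huniv ▸ Set.mem_univ k
      simpa using this
    have := h1 1
    have := h1 g
    have := h1 h
    grind
  by_cases hf : ∀ g, f g = 1
  -- Sending ε to 0 induces the trivial endomorphism.
  · refine ⟨(TrivSqZeroExt.inlHom (ZMod 2) (ZMod 2)).comp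
      (TrivSqZeroExt.fstHom ℕ (ZMod 2) (ZMod 2)).toRingHom, fun u => ?_⟩
    rw [hf, map_eq_one_iff e e.injective]
    have hu : IsUnit (TrivSqZeroExt.fst (u : DualNumber (ZMod 2))) :=
      TrivSqZeroExt.isUnit_iff_isUnit_fst.mp u.isUnit
    have h1 : TrivSqZeroExt.fst (u : DualNumber (ZMod 2)) = 1 := by
      obtain ⟨v, hv⟩ := hu
      rw [← hv, Subsingleton.elim v 1, Units.val_one]
    ext1
    simp [h1]
  · refine ⟨RingHom.id _, fun u => ?_⟩
    push Not at hf
    obtain ⟨g, hg⟩ := hf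
    have hg1 : g ≠ 1 := by rintro rfl; exact hg (map_one f)
    have hfid (k : G) : f k = k := by
      by_cases hk : k = 1
      · rw [hk, map_one]
      · rw [two k g hk hg1]
        exact two _ _ hg hg1
    rw [hfid]
    congr 1

theorem hasOnlyTrivialNormalSubgroups_perm_iff {n : ℕ} (hn : 1 ≤ n) :
    HasOnlyTrivialNormalSubgroups (Perm (Fin n)) ↔ n = 1 ∨ n = 2 := by
  constructor
  · intro h
    by_contra! hne
    have h3 : 3 ≤ n := by omega
    rcases h (alternatingGroup (Fin n)) inferInstance with h | h
    · have := alternatingGroup.nontrivial_of_three_le_card (α := Fin n) (by simpa using h3)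
      exact (Subgroup.nontrivial_iff_ne_bot _).mp this h
    · have hm : swap (⟨0, by omega⟩ : Fin n) ⟨1, by omega⟩ ∈ alternatingGroup (Fin n) :=
        h ▸ Subgroup.mem_top _
      rw [Perm.mem_alternatingGroup, Perm.sign_swap (by simp)] at hm
      exact absurd hm (by decide)
  · rintro (rfl | rfl) N hN
    · exact Or.inl (Subsingleton.elim _ _)
    · have : IsSimpleGroup (Perm (Fin 2)) :=
        isSimpleGroup_of_prime_card (p := 2) (by rw [Nat.card_perm, Nat.card_fin, Nat.factorial_two])
      exact hN.eq_bot_or_eq_top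

end

theorem mainTheorem3 (n : ℕ) (hn : 1 ≤ n) :
    List.TFAE [
      n = 1 ∨ n = 2,
      FullyRealizable.{u} (Equiv.Perm (Fin n)),
      HasOnlyTrivialNormalSubgroups (Equiv.Perm (Fin n))] := by
  tfae_have 1 → 2 := by
    rintro (rfl | rfl)
    · exact ⟨ULift (ZMod 2), inferInstance, (fullyRealizes_zmod_two _).of_ringEquiv ULift.ringEquiv⟩
    · exact ⟨ULift (DualNumber (ZMod 2)), inferInstance,
        (fullyRealizes_dualNumber (by rw [Nat.card_perm, Nat.card_fin, Nat.factorial_two])).of_ringEquiv ULift.ringEquiv⟩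
  tfae_have 2 → 1 := by
    rintro ⟨R, _, hR⟩
    by_contra! hne
    exact not_fullyRealizes_perm_fin (by omega) hR
  tfae_have 3 ↔ 1 := hasOnlyTrivialNormalSubgroups_perm_iff hn
  tfae_finish
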